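/- Let $P=(p_{ij})$ be an irreducible non-negative integer $k\times k$ matrix whose Perron--Frobenius eigenvalue $\lambda$ satisfies $\lambda>1$, and let $r=p/q$ ($p,q$ positive integers) be greater than every row sum of $P$. For $m\ge 1$ let $V_m=\langle a_1,\dots,a_m \mid [a_i,\,a_{i+1}\cdots a_m]=1\ (1\le i<m)\rangle$. Equivalently, $V_m$ is obtained for $m\ge2$ from $m-1$ copies $\langle a_i,b_i\rangle$ of $\mathbb Z^2$ by adding the relations $b_i=a_{i+1}b_{i+1}$ $(1\le i\le m-2)$ and putting $a_m=b_{m-1}$, and $V_1=\langle a_1\rangle\cong\mathbb Z$. The diagonal element of $V_m$ is $c=a_1\cdots a_m$. Let $\Gamma$ be a directed graph with vertices $v_1,\dots,v_k$ and exactly $p_{ij}$ edges from $v_i$ to $v_j$; label its edges $e_1,\dots,e_n$ in any way, and let $e_l$ run from $v_{\rho(l)}$ to $v_{\sigma(l)}$. Let $G_{v_i}$ be a copy of $V_{m_i}$, where $m_i$ is the $i$-th row sum of $P$, with standard generators, in order, the $a_l$ with $\rho(l)=i$, and let $c_i$ be its diagonal element. For a maximal tree $T$ of $\Gamma$, let $$G_{r,P}=\langle\,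 G_{v_1},\dots,G_{v_k},s_1,\dots,s_n \mid s_l^{-1}a_l^{\,p}s_l=c_{\sigma(l)}^{\,q}\ (1\le l\le n),\ s_l=1\ (e_l\in T)\,\rangle .$$ Then there is a constant $D>0$, depending only on $P$ and $r=p/q$ (that is, on $P$, $p$ and $q$, and not on the labelling or on $T$), with the following property. If $c=c_i$ is the diagonal element of any of the vertex groups, $N$ is an integer, and $w$ is a word in the generators $a_1,\dots,a_n,s_1,\dots,s_n$ and their inverses that represents $c^N$ in $G_{r,P}$, then $$|N|\le D\,|w|^{\alpha},\qquad \alpha=\log_\lambda r,$$ where $|w|$ is the length of $w$. -/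

import Mathlib

namespace Snowflake

/-- `μ` is the Perron-Frobenius eigenvalue of the square real matrix `A`: the eigenvalue that has
an eigenvector with positive coordinates. -/
def IsPerronFrobeniusEigenvalue {k : ℕ} (A : Matrix (Fin k) (Fin k) ℝ) (μ : ℝ) : Prop :=
  ∃ x : Fin k → ℝ, Module.End.HasEigenvector (Matrix.toLin' A) μ x ∧ ∀ i, 0 < x i

/-- The functions `ρ` (initial vertex) and `σ` (terminal vertex) describe a directed graph with
edge set `Fin n` and vertex set `Fin k` having exactly `P i j` edges from `i` to `j`. -/
def IsGraphOf {k n : ℕ} (P : Matrix (Fin k) (Fin k) ℕ) (ρ σ : Fin n → Fin k) : Prop :=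
  ∀ i j, (Finset.univ.filter fun e : Fin n => ρ e = i ∧ σ e = j).card = P i j

/-- The edge set `T` is a maximal tree of the (undirected multigraph underlying the) graph with
initial and terminal vertex maps `ρ` and `σ`: it contains no loops and no two parallel edges, and
its edges form a tree on the set of all vertices. -/
structure IsMaximalTree {k n : ℕ} (ρ σ : Fin n → Fin k) (T : Set (Fin n)) : Prop where
  no_loops : ∀ e ∈ T, ρ e ≠ σ e
  no_parallel : Set.InjOn (fun e => s(ρ e, σ e)) T
  isTree : (SimpleGraph.fromEdgeSet ((fun e => s(ρ e, σ e)) '' T)).IsTree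

/-- The generators `a_1, …, a_n, s_1, …, s_n`. -/
inductive Gen (n : ℕ) : Type
  | a (e : Fin n) : Gen n
  | s (e : Fin n) : Gen n

/-- The product of the generators `a_e`, `e ∈ S`, in increasing order of `e`. -/
def aProd {n : ℕ} (S : Finset (Fin n)) : FreeGroup (Gen n) :=
  (S.sort.map fun e => FreeGroup.of (Gen.a e)).prod

/-- The word for the diagonal element of the vertex group at `v`: the product, in order, of the
standard generators `a_e`, `ρ e = v`, of this vertex group. -/
def diagWord {k n : ℕ} (ρ : Fin n → Fin k) (v : Fin k) : FreeGroup (Gen n) :=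
  aProd (Finset.univ.filter fun e => ρ e = v)

/-- The product of the standard generators that come after `a_e` in the vertex group which contains
`a_e`. If the standard generators of that group are `a_1, …, a_m` (in order) and `a_e = a_i`, this
is the element `b_i = a_{i+1} ⋯ a_m`; so `b_i = a_{i+1} b_{i+1}` for `i < m - 1`,
`b_{m-1} = a_m`, and it is empty for `i = m`. -/
def bWord {k n : ℕ} (ρ : Fin n → Fin k) (e : Fin n) : FreeGroup (Gen n) :=
  aProd (Finset.univ.filter fun f => ρ f = ρ e ∧ e < f)

/-- Relators of the snowflake group.

* `vertex`: the relators `[a_i, b_i]` of the vertex groups. The vertex group with standard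
  generators `a_1, …, a_m` is `V_m = ⟨a_1, …, a_m | [a_i, a_{i+1} ⋯ a_m], 1 ≤ i < m⟩`, that is, the
  amalgam of the groups `ℤ² = ⟨a_i, b_i⟩`, `1 ≤ i ≤ m - 1`, along `b_i = a_{i+1} b_{i+1}`, with
  `a_m = b_{m-1}`; it is infinite cyclic for `m = 1`. (For `i = m` the relator is trivial.)
* `edge`: `s_e⁻¹ a_e ^ p s_e = c_{σ e} ^ q`, with `c_v` the diagonal element at `v`.
* `tree`: `s_e = 1` for the edges `e` of the maximal tree `T`. -/
inductive Relator {k n : ℕ} (p q : ℕ) (ρ σ : Fin n → Fin k) (T : Set (Fin n)) :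
    FreeGroup (Gen n) → Prop
  | vertex (e : Fin n) : Relator p q ρ σ T
      (FreeGroup.of (Gen.a e) * bWord ρ e * (FreeGroup.of (Gen.a e))⁻¹ * (bWord ρ e)⁻¹)
  | edge (e : Fin n) : Relator p q ρ σ T
      ((FreeGroup.of (Gen.s e))⁻¹ * FreeGroup.of (Gen.a e) ^ p * FreeGroup.of (Gen.s e) *
        (diagWord ρ (σ e) ^ q)⁻¹)
  | tree (e : Fin n) (he : e ∈ T) : Relator p q ρ σ T (FreeGroup.of (Gen.s e))

/-- The snowflake group `G_{r,P}`, `r = p / q`: the fundamental group (with respect to the maximal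
tree `T`) of the graph of groups whose underlying graph is given by `ρ` and `σ`, whose group at the
vertex `v` is `V_m` on the generators `a_e` with `ρ e = v`, and whose edge groups are infinite
cyclic, attached along `a_e ^ p` at `ρ e` and `c_{σ e} ^ q` at `σ e`. -/
abbrev SnowflakeGroup {k n : ℕ} (p q : ℕ) (ρ σ : Fin n → Fin k) (T : Set (Fin n)) : Type :=
  PresentedGroup {g | Relator p q ρ σ T g}

/-- The element of the snowflake group represented by a free group element. -/
def toGroup {k n : ℕ} (p q : ℕ) (ρ σ : Fin n → Fin k) (T : Set (Fin n)) :
    FreeGroup (Gen n) →* SnowflakeGroup p q ρ σ T :=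
  PresentedGroup.mk {g | Relator p q ρ σ T g}

/-- The diagonal element `c_v` of the vertex group at `v`. -/
def diag {k n : ℕ} (p q : ℕ) (ρ σ : Fin n → Fin k) (T : Set (Fin n)) (v : Fin k) :
    SnowflakeGroup p q ρ σ T :=
  toGroup p q ρ σ T (diagWord ρ v)

/-- The element of the snowflake group represented by a (not necessarily reduced) word in the
generators `a_1, …, a_n, s_1, …, s_n` and their inverses; `(x, true)` stands for `x` and
`(x, false)` for its inverse. -/
def wordValue {k n : ℕ} (p q : ℕ) (ρ σ : Fin n → Fin k) (T : Set (Fin n))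
    (w : List (Gen n × Bool)) : SnowflakeGroup p q ρ σ T :=
  toGroup p q ρ σ T (FreeGroup.mk w)

end Snowflake

/-!
The vertex groups enter only through their abelianizations, and a lower bound for word length is
obtained from an action of the snowflake group on a set `Y` together with a real function `f` on
`Y`: the length of a word is at least, up to a constant factor, the amount by which it changes `f`
at some point.

Let `A` be the free abelian group on the edges, `x` the Perron-Frobenius eigenvector, `r = p / q`
and `β = 1 / α`, so that `r ^ β = λ`; since `λ` is at most the largest row sum, `λ < r` and `β < 1`.
There is a seminorm `ν` on `A` (`VertexWeights.seminorm`) such that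
`ν (N c_v) = x_v |N| ^ β` for the diagonal elements (`VertexWeights.seminorm_smul_diagVec`) and
`ν (K a_e) = x_{σ e} / λ |K| ^ β` for the generators (`VertexWeights.seminorm_smul_single`). That
neither value drops below the prescribed one follows from the eigenvector equation and the
subadditivity of `t ↦ |t| ^ β`. Since `r ^ β = λ`, the edge relations match the cyclic subgroups
generated by `a_e ^ p` and `c_{σ e} ^ q` isometrically.

No normal forms for graphs of groups are needed to pass from `A` to the snowflake group. Let `Y` be
the disjoint union of copies of `A`, one for each `1`-Lipschitz function `φ` on `A` (and each
element of a large index set), and let `f` be `φ` on the copy belonging to `φ`. Translation by `a` changes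
`f` by at most `ν a`, and by exactly `ν a` at some point. By McShane's extension theorem, the
restrictions of `f` to the orbits of `a_e ^ p` and to those of `c_{σ e} ^ q` form the same family of
functions on `ℤ`, so the orbits can be matched by a permutation of `Y` that preserves `f` and
conjugates one translation to the other (`exists_stableLetter`). These permutations are the stable
letters; those in the maximal tree are made trivial by conjugating each vertex group by an
`f`-preserving permutation (`exists_maximalTree_potential`). In the resulting action the `s_e`
preserve `f`, the `a_e` change it by a bounded amount, and `c_v ^ N` changes it by `x_v |N| ^ β`
somewhere (`VertexWeights.mul_abs_rpow_le_length_mul`).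
-/

namespace Snowflake

/-! ### Length-preserving extensions of isometric partial isomorphisms -/

open Cardinal in
/-- Two maps with the same range have isomorphic fibres once their domains are multiplied by a set
that is infinite and at least as large as both of them. -/
theorem exists_equiv_prod_over {α β γ K : Type} [Infinite K] (f : α → γ) (g : β → γ)
    (hfg : Set.range f = Set.range g) (hα : #α ≤ #K) (hβ : #β ≤ #K) :
    ∃ E : α × K ≃ β × K, ∀ z, g (E z).1 = f z.1 := by
  have key : ∀ c : γ, Nonempty ({z : α × K // f z.1 = c} ≃ {z : β × K // g z.1 = c}) := by
    have aux : ∀ {δ : Type} (h : δ → γ) (_ : #δ ≤ #K) (d : δ),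
        #{z : δ × K // h z.1 = h d} = #K := by
      intro δ h hδ d
      apply le_antisymm
      · calc #{z : δ × K // h z.1 = h d} ≤ #(δ × K) := mk_subtype_le _
          _ = #δ * #K := by simp
          _ ≤ #K * #K := by gcongr
          _ = #K := mul_eq_self (aleph0_le_mk K)
      · exact mk_le_of_injective (f := fun k : K => ⟨(d, k), rfl⟩)
          (fun k k' hk => by simpa using hk)
    intro c
    by_cases hc : c ∈ Set.range f
    · obtain ⟨a, rfl⟩ := id hc
      obtain ⟨b, hb⟩ := hfg ▸ hc
      refine Cardinal.eq.1 ((aux f hα a).trans ?_)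
      rw [← hb]
      exact (aux g hβ b).symm
    · have h1 : IsEmpty {z : α × K // f z.1 = c} := ⟨fun z => hc ⟨_, z.2⟩⟩
      have h2 : IsEmpty {z : β × K // g z.1 = c} := ⟨fun z => (hfg ▸ hc) ⟨_, z.2⟩⟩
      exact ⟨Equiv.equivOfIsEmpty _ _⟩
  refine ⟨(Equiv.sigmaFiberEquiv fun z : α × K => f z.1).symm.trans
    ((Equiv.sigmaCongrRight fun c => (key c).some).trans
      (Equiv.sigmaFiberEquiv fun z : β × K => g z.1)), fun z => ?_⟩
  exact ((key (f z.1)).some ⟨z, rfl⟩).2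

/-- Coordinates on `A` adapted to the translation action of `u`: the point at position `m` on the
orbit `x`, with a chosen representative of `x` as origin of the orbit. -/
noncomputable def orbitCoord {A : Type} [AddCommGroup A] (u : A)
    (z : ℤ × (A ⧸ AddSubgroup.zmultiples u)) : A :=
  z.1 • u + z.2.out

theorem orbitCoord_bijective {A : Type} [AddCommGroup A] {u : A}
    (hu : ∀ m : ℤ, m • u = 0 → m = 0) : Function.Bijective (orbitCoord u) := by
  constructor
  · rintro ⟨m, x⟩ ⟨m', x'⟩ h
    have h0 : m • u + x.out = m' • u + x'.out := h
    have hx : x = x' := by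
      have := congrArg (QuotientAddGroup.mk : A → A ⧸ AddSubgroup.zmultiples u) h0
      rw [QuotientAddGroup.mk_add, QuotientAddGroup.mk_add, QuotientAddGroup.out_eq',
        QuotientAddGroup.out_eq',
        (QuotientAddGroup.eq_zero_iff _).2 (AddSubgroup.mem_zmultiples_iff.2 ⟨m, rfl⟩),
        (QuotientAddGroup.eq_zero_iff _).2 (AddSubgroup.mem_zmultiples_iff.2 ⟨m', rfl⟩)] at this
      simpa using this
    subst hx
    have := hu (m - m') (by rw [sub_smul, add_right_cancel h0, sub_self])
    rw [sub_eq_zero.1 this]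
  · intro a
    obtain ⟨⟨h, hh⟩, hout⟩ := QuotientAddGroup.mk_out_eq_add (AddSubgroup.zmultiples u) a
    obtain ⟨m, rfl⟩ := AddSubgroup.mem_zmultiples_iff.1 hh
    refine ⟨(-m, a), ?_⟩
    simp only [orbitCoord, hout]
    simp

/-- The real functions on `A` that are `1`-Lipschitz for the seminorm `ν`. -/
abbrev LipFun {A : Type} [AddCommGroup A] (ν : AddGroupSeminorm A) : Type :=
  {φ : A → ℝ // ∀ a b, φ a - φ b ≤ ν (a - b)}

/-- McShane's extension theorem for functions on the cyclic subgroup generated by `u`. -/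
theorem exists_lipFun_extension {A : Type} [AddCommGroup A] (ν : AddGroupSeminorm A) (u : A)
    (ψ : ℤ → ℝ) (hψ : ∀ m m', ψ m - ψ m' ≤ ν ((m - m') • u)) :
    ∃ φ : LipFun ν, ∀ m : ℤ, φ.1 (m • u) = ψ m := by
  have bdd : ∀ a : A, BddBelow (Set.range fun m : ℤ => ψ m + ν (a - m • u)) := by
    intro a
    refine ⟨ψ 0 - ν a, ?_⟩
    rintro _ ⟨m, rfl⟩
    have h1 := hψ 0 m
    have h2 : ν ((0 - m) • u) ≤ ν a + ν (a - m • u) := by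
      have h3 := map_add_le_add ν (-a) (a - m • u)
      rw [map_neg_eq_map] at h3
      rwa [show -a + (a - m • u) = (0 - m) • u by rw [sub_smul, zero_smul]; abel] at h3
    linarith
  refine ⟨⟨fun a => ⨅ m : ℤ, ψ m + ν (a - m • u), fun a b => ?_⟩, fun m => ?_⟩
  · rw [sub_le_iff_le_add', ← sub_le_iff_le_add]
    refine le_ciInf fun m => ?_
    have h1 := ciInf_le (bdd a) m
    have h2 : ν (a - m • u) ≤ ν (a - b) + ν (b - m • u) := by
      simpa using map_add_le_add ν (a - b) (b - m • u)
    linarith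
  · apply le_antisymm
    · simpa using ciInf_le (bdd (m • u)) m
    · refine le_ciInf fun m' => ?_
      have h1 := hψ m m'
      rw [sub_smul] at h1
      linarith

/-- A disjoint union of copies of the `A`-set `A`. The copies are indexed by the `1`-Lipschitz
functions on `A`, each of which occurs `#(A × (A → ℝ))` times; the last factor serves only to make
fibres equinumerous. -/
abbrev ActionSpace {A : Type} [AddCommGroup A] (ν : AddGroupSeminorm A) : Type :=
  A × LipFun ν × (A × (A → ℝ))

/-- The real function which on each copy of `A` is the `1`-Lipschitz function indexing the copy. -/
def height {A : Type} [AddCommGroup A] (ν : AddGroupSeminorm A) (y : ActionSpace ν) : ℝ :=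
  y.2.1.1 y.1

/-- The action of `A` by translation on each copy of `A`. -/
def translation {A : Type} [AddCommGroup A] (ν : AddGroupSeminorm A) :
    Multiplicative A →* Equiv.Perm (ActionSpace ν) where
  toFun a := Equiv.prodCongr (Equiv.addLeft a.toAdd) (Equiv.refl _)
  map_one' := by ext y <;> simp
  map_mul' a b := by ext y <;> simp [add_assoc]

theorem abs_height_translation_sub_le {A : Type} [AddCommGroup A] (ν : AddGroupSeminorm A) (a : A)
    (y : ActionSpace ν) :
    |height ν (translation ν (.ofAdd a) y) - height ν y| ≤ ν a := by
  have h1 := y.2.1.2 (a + y.1) y.1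
  have h2 := y.2.1.2 y.1 (a + y.1)
  rw [add_sub_cancel_right] at h1
  rw [sub_add_cancel_right, map_neg_eq_map] at h2
  exact abs_sub_le_iff.2 ⟨h1, h2⟩

theorem exists_height_translation_eq {A : Type} [AddCommGroup A] (ν : AddGroupSeminorm A) (a : A) :
    ∃ y : ActionSpace ν, height ν (translation ν (.ofAdd a) y) - height ν y = ν a := by
  refine ⟨(0, ⟨ν, fun a b => ?_⟩, 0), ?_⟩
  · have := map_add_le_add ν (a - b) b
    rw [sub_add_cancel] at this
    linarith
  · simp [height, translation]

/-- The functions on `ℤ` obtained by restricting `1`-Lipschitz functions to orbits of `u` depend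
only on the restriction of `ν` to the cyclic subgroup generated by `u`. -/
theorem range_orbit_restriction {A : Type} [AddCommGroup A] (ν : AddGroupSeminorm A) (u : A) :
    Set.range (fun z : (A ⧸ AddSubgroup.zmultiples u) × LipFun ν =>
      fun m : ℤ => z.2.1 (orbitCoord u (m, z.1))) =
    {ψ | ∀ m m', ψ m - ψ m' ≤ ν ((m - m') • u)} := by
  ext ψ
  constructor
  · rintro ⟨⟨x, φ⟩, rfl⟩ m m'
    simpa [orbitCoord, sub_smul] using φ.2 (m • u + x.out) (m' • u + x.out)
  · intro hψ
    obtain ⟨φ, hφ⟩ := exists_lipFun_extension ν u ψ hψ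
    let x : A ⧸ AddSubgroup.zmultiples u := 0
    -- The orbit of the coset `0` has origin `x.out`, which need not be `0`.
    refine ⟨(x, ⟨fun a => φ.1 (a - x.out), fun a b => ?_⟩), ?_⟩
    · simpa using φ.2 (a - x.out) (b - x.out)
    · funext m
      simp [orbitCoord, hφ]

open Cardinal in
/-- An isomorphism between cyclic subgroups of `A` that preserves the seminorm is realized, on
`ActionSpace ν`, as conjugation by a permutation preserving the height: the orbits of `w` and of `u`
can be matched so that the restrictions of the height to matched orbits agree. -/
theorem exists_stableLetter {A : Type} [AddCommGroup A] (ν : AddGroupSeminorm A) {u w : A}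
    (hu : ∀ m : ℤ, m • u = 0 → m = 0) (hw : ∀ m : ℤ, m • w = 0 → m = 0)
    (huw : ∀ m : ℤ, ν (m • u) = ν (m • w)) :
    ∃ s : Equiv.Perm (ActionSpace ν), (∀ y, height ν (s y) = height ν y) ∧
      s⁻¹ * translation ν (.ofAdd u) * s = translation ν (.ofAdd w) := by
  have card : ∀ v : A, #((A ⧸ AddSubgroup.zmultiples v) × LipFun ν) ≤ #(A × (A → ℝ)) := fun v =>
    mk_le_of_injective (f := fun z => (z.1.out, z.2.1)) (by
      rintro ⟨x, φ⟩ ⟨x', φ'⟩ h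
      simp only [Prod.mk.injEq] at h
      exact Prod.ext (Quotient.out_injective h.1) (Subtype.ext h.2))
  have : Infinite (A → ℝ) := inferInstance
  have : Infinite (A × (A → ℝ)) := inferInstance
  obtain ⟨E, hE⟩ := exists_equiv_prod_over (K := A × (A → ℝ)) _ _
    ((range_orbit_restriction ν w).trans (by
      rw [range_orbit_restriction ν u]; simp only [huw])) (card w) (card u)
  have coord : ∀ v : A, (∀ m : ℤ, m • v = 0 → m = 0) →
      ∃ e : (ℤ × ((A ⧸ AddSubgroup.zmultiples v) × LipFun ν) × (A × (A → ℝ))) ≃ ActionSpace ν,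
        ∀ m x φ κ, e (m, (x, φ), κ) = (m • v + x.out, φ, κ) := fun v hv =>
    ⟨(((Equiv.prodCongr (Equiv.refl ℤ) (Equiv.prodAssoc _ _ _)).trans
        (Equiv.prodAssoc _ _ _).symm).trans
        (Equiv.prodCongr (Equiv.ofBijective _ (orbitCoord_bijective hv)) (Equiv.refl _))),
      fun _ _ _ _ => rfl⟩
  obtain ⟨eu, heu⟩ := coord u hu
  obtain ⟨ew, hew⟩ := coord w hw
  have shift : ∀ (v : A) (e : (ℤ × ((A ⧸ AddSubgroup.zmultiples v) × LipFun ν) × (A × (A → ℝ))) ≃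
      ActionSpace ν) (_ : ∀ m x φ κ, e (m, (x, φ), κ) = (m • v + x.out, φ, κ)) m o,
      translation ν (.ofAdd v) (e (m, o)) = e (m + 1, o) := by
    rintro v e he m ⟨⟨x, φ⟩, κ⟩
    rw [he, he]
    simp only [translation, MonoidHom.coe_mk, OneHom.coe_mk, Equiv.prodCongr_apply, Prod.map,
      Equiv.coe_addLeft, toAdd_ofAdd, Equiv.refl_apply, add_smul, one_smul]
    rw [← add_assoc, add_comm v]
  -- The orbit `o` of `w` is sent to the orbit `E o` of `u`, keeping the position `m`.
  refine ⟨(ew.symm.trans (Equiv.prodCongr (Equiv.refl ℤ) E)).trans eu, fun y => ?_, ?_⟩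
  · obtain ⟨⟨m, ⟨x, φ⟩, κ⟩, rfl⟩ := ew.surjective y
    have h := congrFun (hE ((x, φ), κ)) m
    obtain ⟨⟨⟨x', φ'⟩, κ'⟩, hEx⟩ : ∃ o, E ((x, φ), κ) = o := ⟨_, rfl⟩
    rw [hEx] at h
    simp only [Equiv.trans_apply, Equiv.symm_apply_apply, Equiv.prodCongr_apply, Prod.map,
      Equiv.refl_apply, hEx]
    rw [heu, hew]
    exact h
  · rw [mul_assoc, inv_mul_eq_iff_eq_mul]
    ext1 y
    obtain ⟨⟨m, o⟩, rfl⟩ := ew.surjective y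
    simp [shift u eu heu, shift w ew hew]

/-! ### A seminorm on the free abelian group on the edges -/

/-- The image of the diagonal element at `v` in the free abelian group on the edges: the indicator
function of the set of edges starting at `v`. -/
def diagVec {k n : ℕ} (ρ : Fin n → Fin k) (v : Fin k) : Fin n → ℤ :=
  fun e => if ρ e = v then 1 else 0

theorem diagVec_eq_sum {k n : ℕ} (ρ : Fin n → Fin k) (v : Fin k) :
    diagVec ρ v = ∑ e with ρ e = v, Pi.single e 1 := by
  ext f
  simp [diagVec, Finset.sum_apply, Pi.single_apply]

/-- A positive vector `x` with `∑_{ρ e = v} x (σ e) = lam * x v` for every vertex `v`, that is, a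
positive eigenvector of the adjacency matrix of the graph, together with an exponent `β ∈ (0, 1]`.
These are the data entering the definition of `VertexWeights.seminorm`; in the application `β` is
the inverse of the distortion exponent. -/
structure VertexWeights {k n : ℕ} (ρ σ : Fin n → Fin k) where
  x : Fin k → ℝ
  lam : ℝ
  β : ℝ
  x_pos : ∀ v, 0 < x v
  lam_pos : 0 < lam
  β_pos : 0 < β
  β_le : β ≤ 1
  sum_eq : ∀ v, ∑ e with ρ e = v, x (σ e) = lam * x v

namespace VertexWeights

variable {k n : ℕ} {ρ σ : Fin n → Fin k} (W : VertexWeights ρ σ)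

/-- The cost of writing `g` as a sum of the diagonal vectors `I v • diagVec ρ v` and a remainder,
where `K` times the diagonal vector at `v` costs `x v * |K| ^ β`, and `K` times the basis vector
`e` costs `x (σ e) / lam * |K| ^ β`. -/
noncomputable def cost (g : Fin n → ℤ) (I : Fin k → ℤ) : ℝ :=
  ∑ e, W.x (σ e) / W.lam * |((g e - I (ρ e) : ℤ) : ℝ)| ^ W.β + ∑ v, W.x v * |(I v : ℝ)| ^ W.β

theorem edge_weight_nonneg (e : Fin n) : 0 ≤ W.x (σ e) / W.lam :=
  (div_pos (W.x_pos _) W.lam_pos).le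

theorem cost_nonneg (g : Fin n → ℤ) (I : Fin k → ℤ) : 0 ≤ W.cost g I :=
  add_nonneg
    (Finset.sum_nonneg fun e _ => mul_nonneg (W.edge_weight_nonneg e) (by positivity))
    (Finset.sum_nonneg fun v _ => mul_nonneg (W.x_pos v).le (by positivity))

theorem cost_bddBelow (g : Fin n → ℤ) : BddBelow (Set.range (W.cost g)) :=
  ⟨0, by rintro _ ⟨I, rfl⟩; exact W.cost_nonneg g I⟩

theorem abs_add_rpow_le (a b : ℤ) :
    |((a + b : ℤ) : ℝ)| ^ W.β ≤ |(a : ℝ)| ^ W.β + |(b : ℝ)| ^ W.β := by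
  push_cast
  exact (Real.rpow_le_rpow (abs_nonneg _) (abs_add_le _ _) W.β_pos.le).trans
    (Real.rpow_add_le_add_rpow (abs_nonneg _) (abs_nonneg _) W.β_pos.le W.β_le)

theorem cost_add_le (g h : Fin n → ℤ) (I J : Fin k → ℤ) :
    W.cost (g + h) (I + J) ≤ W.cost g I + W.cost h J := by
  simp only [cost]
  rw [add_add_add_comm, ← Finset.sum_add_distrib, ← Finset.sum_add_distrib]
  refine add_le_add (Finset.sum_le_sum fun e _ => ?_) (Finset.sum_le_sum fun v _ => ?_)
  · rw [← mul_add, Pi.add_apply, Pi.add_apply, add_sub_add_comm]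
    exact mul_le_mul_of_nonneg_left (W.abs_add_rpow_le _ _) (W.edge_weight_nonneg e)
  · rw [← mul_add, Pi.add_apply]
    exact mul_le_mul_of_nonneg_left (W.abs_add_rpow_le _ _) (W.x_pos v).le

theorem cost_neg (g : Fin n → ℤ) (I : Fin k → ℤ) : W.cost (-g) (-I) = W.cost g I := by
  simp only [cost, Pi.neg_apply, Int.cast_neg, abs_neg]
  congr 2 with e
  rw [← neg_sub', Int.cast_neg, abs_neg]

/-- The largest seminorm on the free abelian group on the edges for which the `K`-th powers of the
diagonal element at `v` and of the generator `e` have length at most `x v * |K| ^ β` and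
`x (σ e) / lam * |K| ^ β`, respectively. -/
noncomputable def seminorm : AddGroupSeminorm (Fin n → ℤ) where
  toFun g := ⨅ I, W.cost g I
  map_zero' := by
    refine le_antisymm ((ciInf_le (W.cost_bddBelow 0) 0).trans_eq ?_)
      (le_ciInf fun I => W.cost_nonneg 0 I)
    simp [cost, Real.zero_rpow W.β_pos.ne']
  add_le' g h := le_ciInf_add_ciInf fun I J =>
    (ciInf_le (W.cost_bddBelow _) (I + J)).trans (W.cost_add_le g h I J)
  neg' g := by
    refine (Equiv.iInf_congr (Equiv.neg _) fun I => ?_).symm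
    simpa using W.cost_neg g I

/-- The shortcut through the diagonal element at `ρ e` does not make powers of the generator `e` any
shorter, because `x (σ e) ≤ lam * x (ρ e)`. -/
theorem seminorm_smul_single (K : ℤ) (e : Fin n) :
    W.seminorm (K • Pi.single e 1) = W.x (σ e) / W.lam * |(K : ℝ)| ^ W.β := by
  have hz := Real.zero_rpow W.β_pos.ne'
  apply le_antisymm
  · refine (ciInf_le (W.cost_bddBelow _) 0).trans_eq ?_
    simp only [cost, Pi.zero_apply, Int.cast_zero, abs_zero, hz, mul_zero, Finset.sum_const_zero,
      add_zero, sub_zero]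
    rw [Finset.sum_eq_single e]
    · simp
    · intro f _ hf
      simp [hf, hz]
    · simp
  · refine le_ciInf fun I => ?_
    have hle : W.x (σ e) / W.lam ≤ W.x (ρ e) := by
      rw [div_le_iff₀' W.lam_pos, ← W.sum_eq]
      exact Finset.single_le_sum (f := fun f => W.x (σ f)) (fun f _ => (W.x_pos _).le) (by simp)
    have h1 := W.abs_add_rpow_le (K - I (ρ e)) (I (ρ e))
    rw [sub_add_cancel] at h1
    calc _ ≤ W.x (σ e) / W.lam *
            (|((K - I (ρ e) : ℤ) : ℝ)| ^ W.β + |(I (ρ e) : ℝ)| ^ W.β) :=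
          mul_le_mul_of_nonneg_left h1 (W.edge_weight_nonneg e)
      _ ≤ W.x (σ e) / W.lam * |((K - I (ρ e) : ℤ) : ℝ)| ^ W.β +
            W.x (ρ e) * |(I (ρ e) : ℝ)| ^ W.β := by
          rw [mul_add]
          exact add_le_add_right (mul_le_mul_of_nonneg_right hle (by positivity)) _
      _ ≤ _ := by
          refine add_le_add ?_ (Finset.single_le_sum
            (f := fun v => W.x v * |(I v : ℝ)| ^ W.β)
            (fun v _ => mul_nonneg (W.x_pos v).le (by positivity)) (Finset.mem_univ (ρ e)))
          convert Finset.single_le_sum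
            (f := fun f => W.x (σ f) / W.lam *
              |(((K • Pi.single e 1 : Fin n → ℤ) f - I (ρ f) : ℤ) : ℝ)| ^ W.β)
            (fun f _ => mul_nonneg (W.edge_weight_nonneg f) (by positivity)) (Finset.mem_univ e)
            using 1
          simp

/-- Splitting a diagonal element into generators does not make it any shorter: by the eigenvector
equation at `v`, the cost of `N - I v` copies of each generator at `v` is exactly the cost
`x v * |N - I v| ^ β` of the power `N - I v` of the diagonal element. -/
theorem seminorm_smul_diagVec (N : ℤ) (v : Fin k) :
    W.seminorm (N • diagVec ρ v) = W.x v * |(N : ℝ)| ^ W.β := by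
  have hz := Real.zero_rpow W.β_pos.ne'
  apply le_antisymm
  · refine (ciInf_le (W.cost_bddBelow _) (Pi.single v N)).trans_eq ?_
    simp only [cost]
    rw [Finset.sum_eq_zero, zero_add, Finset.sum_eq_single v]
    · simp
    · intro u _ hu
      simp [hu, hz]
    · simp
    · intro e _
      by_cases h : ρ e = v <;> simp [diagVec, h, hz]
  · refine le_ciInf fun I => ?_
    have h1 := W.abs_add_rpow_le (N - I v) (I v)
    rw [sub_add_cancel] at h1
    calc _ ≤ W.x v * (|((N - I v : ℤ) : ℝ)| ^ W.β + |(I v : ℝ)| ^ W.β) :=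
          mul_le_mul_of_nonneg_left h1 (W.x_pos v).le
      _ = ∑ e with ρ e = v, W.x (σ e) / W.lam * |((N - I v : ℤ) : ℝ)| ^ W.β +
            W.x v * |(I v : ℝ)| ^ W.β := by
          rw [← Finset.sum_mul, ← Finset.sum_div, W.sum_eq, mul_div_cancel_left₀ _ W.lam_pos.ne',
            mul_add]
      _ ≤ _ := by
          refine add_le_add ?_ (Finset.single_le_sum
            (f := fun v => W.x v * |(I v : ℝ)| ^ W.β)
            (fun v _ => mul_nonneg (W.x_pos v).le (by positivity)) (Finset.mem_univ v))
          refine le_trans (Finset.sum_le_sum fun e he => ?_)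
            (Finset.sum_le_univ_sum_of_nonneg (s := {e | ρ e = v}) fun e =>
              mul_nonneg (W.edge_weight_nonneg e) (by positivity))
          simp [diagVec, (Finset.mem_filter.1 he).2]

end VertexWeights

/-! ### Stable letters on a maximal tree -/

/-- A group-valued function on the darts of a tree is the coboundary of a function on the vertices,
namely of the product along the path from a base vertex. -/
theorem exists_potential_of_isTree {V G : Type*} [Group G] {Γ : SimpleGraph V} (hΓ : Γ.IsTree)
    (h : V → V → G) (hh : ∀ u v, Γ.Adj u v → h u v * h v u = 1) :
    ∃ γ : V → G, ∀ u v, Γ.Adj u v → γ v = γ u * h u v := by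
  classical
  -- `val` is the product of `h` along a walk, and `W v` is the path from the base vertex `r`.
  let val : ∀ {u v : V}, Γ.Walk u v → G := fun {u v} W => (W.darts.map fun d => h d.fst d.snd).prod
  obtain ⟨r⟩ := hΓ.1.nonempty
  choose W hW using fun v => (hΓ.existsUnique_path r v).exists
  have step : ∀ u v, Γ.Adj u v → v ∉ (W u).support → val (W v) = val (W u) * h u v := by
    intro u v huv hv
    have := (hΓ.2.subsingleton_path r v).elim ⟨W v, hW v⟩
      ⟨(W u).concat huv, (hW u).concat hv huv⟩
    rw [show W v = (W u).concat huv from congrArg Subtype.val this]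
    simp [val, SimpleGraph.Walk.darts_concat]
  refine ⟨fun v => val (W v), fun u v huv => ?_⟩
  by_cases hv : v ∈ (W u).support
  · -- The path to `v` is an initial segment of the path to `u`, so `u` is one step further.
    have hu : u ∉ (W v).support := by
      intro hu
      have h1 := (hΓ.2.subsingleton_path r v).elim ⟨W v, hW v⟩ ⟨_, (hW u).takeUntil hv⟩
      rw [show W v = (W u).takeUntil v hv from congrArg Subtype.val h1] at hu
      exact SimpleGraph.Walk.endpoint_notMem_support_takeUntil (hW u) hv huv.ne hu
    have h2 := step v u huv.symm hu
    simp only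
    rw [h2, mul_assoc, hh v u huv.symm, mul_one]
  · exact step u v huv hv

/-- Stable letters can be made trivial on a maximal tree by a change of base points at the
vertices. -/
theorem exists_maximalTree_potential {k n : ℕ} {ρ σ : Fin n → Fin k} {T : Set (Fin n)}
    (hT : IsMaximalTree ρ σ T) {G : Type*} [Group G] (s : Fin n → G) :
    ∃ γ : Fin k → G, ∀ e ∈ T, γ (σ e) = γ (ρ e) * s e := by
  classical
  rcases Nat.eq_zero_or_pos n with rfl | hn
  · exact ⟨1, fun e => e.elim0⟩
  have : Nonempty (Fin n) := ⟨⟨0, hn⟩⟩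
  -- `pick` recovers an edge of the maximal tree from its pair of endpoints.
  let pick : Sym2 (Fin k) → Fin n := Function.invFunOn (fun e => s(ρ e, σ e)) T
  have hpick : ∀ e ∈ T, pick s(ρ e, σ e) = e := fun e he =>
    hT.no_parallel.leftInvOn_invFunOn he
  let h : Fin k → Fin k → G := fun u v =>
    if ρ (pick s(u, v)) = u then s (pick s(u, v)) else (s (pick s(u, v)))⁻¹
  have hfwd : ∀ e ∈ T, h (ρ e) (σ e) = s e := fun e he => by simp [h, hpick e he]
  have hbwd : ∀ e ∈ T, h (σ e) (ρ e) = (s e)⁻¹ := fun e he => by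
    simp [h, Sym2.eq_swap (a := σ e), hpick e he, hT.no_loops e he]
  obtain ⟨γ, hγ⟩ := exists_potential_of_isTree hT.isTree h (by
    intro u v huv
    obtain ⟨⟨e, he, heq⟩, -⟩ := (SimpleGraph.fromEdgeSet_adj _).1 huv
    rcases Sym2.eq_iff.1 heq with ⟨rfl, rfl⟩ | ⟨rfl, rfl⟩
    · rw [hfwd e he, hbwd e he, mul_inv_cancel]
    · rw [hfwd e he, hbwd e he, inv_mul_cancel])
  refine ⟨γ, fun e he => ?_⟩
  rw [hγ _ _ ((SimpleGraph.fromEdgeSet_adj _).2 ⟨⟨e, he, rfl⟩, hT.no_loops e he⟩), hfwd e he]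

/-! ### The length estimate in the snowflake group -/

/-- If the generators `a_e` at each vertex `v` are mapped through a homomorphism `κ v` defined on
the free abelian group on the edges, so is each product of generators at `v`. -/
theorem map_aProd {k n : ℕ} {ρ : Fin n → Fin k} {G : Type*} [Group G] (F : Gen n → G)
    (κ : Fin k → Multiplicative (Fin n → ℤ) →* G)
    (hF : ∀ e, F (.a e) = κ (ρ e) (.ofAdd (Pi.single e 1))) {v : Fin k} {S : Finset (Fin n)}
    (hS : ∀ e ∈ S, ρ e = v) :
    FreeGroup.lift F (aProd S) = κ v (.ofAdd (∑ e ∈ S, Pi.single e 1)) := by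
  have hlist : ∀ l : List (Fin n), (∀ e ∈ l, ρ e = v) →
      FreeGroup.lift F (l.map fun e => FreeGroup.of (Gen.a e)).prod =
        κ v (.ofAdd (l.map fun e => (Pi.single e 1 : Fin n → ℤ)).sum) := by
    intro l hl
    induction l with
    | nil => simp
    | cons e l ih =>
      rw [List.forall_mem_cons] at hl
      simp [ih hl.2, hF, hl.1]
  rw [aProd, hlist _ fun e he => hS e ((Finset.mem_sort _).1 he)]
  congr 2
  rw [← Multiset.sum_coe, ← Multiset.map_coe, Finset.sort_eq]
  rfl

/-- The permutations that preserve a real function. -/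
def levelPreserving {Y : Type*} (f : Y → ℝ) : Subgroup (Equiv.Perm Y) where
  carrier := {g | ∀ y, f (g y) = f y}
  one_mem' _ := rfl
  mul_mem' hg hh y := (hg _).trans (hh y)
  inv_mem' {g} hg y := by simpa using (hg (g⁻¹ y)).symm

theorem abs_sub_le_length_mul {Y X : Type*} (f : Y → ℝ) (F : X → Equiv.Perm Y) {M : ℝ}
    (hF : ∀ x y, |f (F x y) - f y| ≤ M) (w : List (X × Bool)) (y : Y) :
    |f (FreeGroup.lift F (FreeGroup.mk w) y) - f y| ≤ w.length * M := by
  induction w with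
  | nil => simp [← FreeGroup.one_eq_mk]
  | cons z w ih =>
    obtain ⟨x, b⟩ := z
    rw [FreeGroup.lift_mk] at ih ⊢
    rw [List.map_cons, List.prod_cons, Equiv.Perm.mul_apply]
    set t := (List.map (fun x : X × Bool => bif x.2 then F x.1 else (F x.1)⁻¹) w).prod y
    have h1 : |f ((bif b then F x else (F x)⁻¹) t) - f t| ≤ M := by
      cases b
      · simpa [abs_sub_comm] using hF x ((F x)⁻¹ t)
      · exact hF x t
    have h2 := abs_sub_le (f ((bif b then F x else (F x)⁻¹) t)) (f t) (f y)
    rw [List.length_cons, Nat.cast_succ, add_mul, one_mul]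
    linarith

/-- A word representing the `N`-th power of the diagonal element at `v` has length at least the
seminorm of that power, up to the length `M` of a single generator. The condition `hpq` says that
the edge relations identify elements of the same seminorm. -/
theorem VertexWeights.mul_abs_rpow_le_length_mul {k n : ℕ} {ρ σ : Fin n → Fin k}
    (W : VertexWeights ρ σ) {p q : ℕ} (hp : 0 < p) (hq : 0 < q)
    (hpq : (p : ℝ) ^ W.β = W.lam * (q : ℝ) ^ W.β) {T : Set (Fin n)} (hT : IsMaximalTree ρ σ T)
    {M : ℝ} (hM : 0 ≤ M) (hxM : ∀ v, W.x v / W.lam ≤ M) {v : Fin k} {N : ℤ}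
    {w : List (Gen n × Bool)} (hw : wordValue p q ρ σ T w = diag p q ρ σ T v ^ N) :
    W.x v * |(N : ℝ)| ^ W.β ≤ w.length * M := by
  set ν := W.seminorm
  set f := height ν
  let θ := translation ν
  have hνu : ∀ (e : Fin n) (m : ℤ), ν (m • (p : ℤ) • Pi.single e 1) =
      W.x (σ e) / W.lam * (|(m : ℝ)| ^ W.β * (p : ℝ) ^ W.β) := fun e m => by
    rw [smul_smul, W.seminorm_smul_single, Int.cast_mul, abs_mul, Int.cast_natCast, Nat.abs_cast,
      Real.mul_rpow (abs_nonneg _) (Nat.cast_nonneg _)]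
  have hνw : ∀ (u : Fin k) (m : ℤ), ν (m • (q : ℤ) • diagVec ρ u) =
      W.x u * (|(m : ℝ)| ^ W.β * (q : ℝ) ^ W.β) := fun u m => by
    rw [smul_smul, W.seminorm_smul_diagVec, Int.cast_mul, abs_mul, Int.cast_natCast, Nat.abs_cast,
      Real.mul_rpow (abs_nonneg _) (Nat.cast_nonneg _)]
  have hzero : ∀ {a b : ℝ} (_ : 0 < a) (_ : 0 < b) {m : ℤ} (_ : a * (|(m : ℝ)| ^ W.β * b) = 0),
      m = 0 := by
    intro a b ha hb m h
    by_contra hm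
    have : 0 < |(m : ℝ)| := abs_pos.2 (Int.cast_ne_zero.2 hm)
    exact h.not_gt (by positivity)
  have hstable : ∀ e : Fin n, ∃ s : Equiv.Perm (ActionSpace ν), (∀ y, f (s y) = f y) ∧
      s⁻¹ * θ (.ofAdd ((p : ℤ) • Pi.single e 1)) * s =
        θ (.ofAdd ((q : ℤ) • diagVec ρ (σ e))) := by
    intro e
    refine exists_stableLetter ν (fun m hm => ?_) (fun m hm => ?_) (fun m => ?_)
    · exact hzero (div_pos (W.x_pos (σ e)) W.lam_pos) (Real.rpow_pos_of_pos (Nat.cast_pos.2 hp) _)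
        ((hνu e m).symm.trans (by rw [hm, map_zero]))
    · exact hzero (W.x_pos (σ e)) (Real.rpow_pos_of_pos (Nat.cast_pos.2 hq) _)
        ((hνw (σ e) m).symm.trans (by rw [hm, map_zero]))
    · rw [hνu, hνw, hpq]
      have := W.lam_pos.ne'
      field_simp
  choose s hsf hs using hstable
  obtain ⟨γ, hγ⟩ := exists_maximalTree_potential hT
    (G := levelPreserving f) fun e => ⟨s e, hsf e⟩
  have hγ' : ∀ e ∈ T, (γ (σ e) : Equiv.Perm (ActionSpace ν)) = γ (ρ e) * s e := fun e he =>
    congrArg Subtype.val (hγ e he)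
  let κ : Fin k → Multiplicative (Fin n → ℤ) →* Equiv.Perm (ActionSpace ν) := fun u =>
    (MulAut.conj (γ u : Equiv.Perm (ActionSpace ν))).toMonoidHom.comp θ
  have hκ : ∀ u a, κ u a = γ u * θ a * (γ u : Equiv.Perm (ActionSpace ν))⁻¹ := fun _ _ => rfl
  have hκf : ∀ u a y, f (κ u a y) = f (θ a ((γ u : Equiv.Perm (ActionSpace ν))⁻¹ y)) :=
    fun u a y => (γ u).2 _
  -- The vertex group at `u` acts through `κ u`, that is, by translations seen from `γ u`.
  let F : Gen n → Equiv.Perm (ActionSpace ν)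
    | .a e => κ (ρ e) (.ofAdd (Pi.single e 1))
    | .s e => γ (ρ e) * s e * (γ (σ e) : Equiv.Perm (ActionSpace ν))⁻¹
  have hprod : ∀ {u : Fin k} {S : Finset (Fin n)} (_ : ∀ e ∈ S, ρ e = u),
      FreeGroup.lift F (aProd S) = κ u (.ofAdd (∑ e ∈ S, Pi.single e 1)) :=
    fun hS => map_aProd F κ (fun _ => rfl) hS
  have hdiag : ∀ u, FreeGroup.lift F (diagWord ρ u) = κ u (.ofAdd (diagVec ρ u)) := fun u => by
    rw [diagWord, hprod (u := u) (by simp), diagVec_eq_sum]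
  have hrel : ∀ g ∈ {g | Relator p q ρ σ T g}, FreeGroup.lift F g = 1 := by
    rintro _ (e | e | ⟨e, he⟩)
    · have hb : FreeGroup.lift F (bWord ρ e) =
          κ (ρ e) (.ofAdd (∑ f with ρ f = ρ e ∧ e < f, Pi.single f 1)) :=
        hprod (by simp +contextual)
      simp only [map_mul, map_inv, hb, FreeGroup.lift_apply_of, F]
      rw [← map_mul, mul_comm, map_mul]
      group
    · simp only [map_mul, map_inv, map_pow, hdiag, FreeGroup.lift_apply_of, F]
      have hs' := hs e
      rw [natCast_zsmul, natCast_zsmul, ofAdd_nsmul, ofAdd_nsmul] at hs'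
      rw [← map_pow (κ (ρ e)), ← map_pow (κ (σ e)), hκ, hκ, ← hs']
      group
    · simp [F, hγ' e he]
  have hFM : ∀ x y, |f (F x y) - f y| ≤ M := by
    rintro (e | e) y
    · have h1 := abs_height_translation_sub_le ν (Pi.single e 1)
        ((γ (ρ e) : Equiv.Perm (ActionSpace ν))⁻¹ y)
      have h2 : f ((γ (ρ e) : Equiv.Perm (ActionSpace ν))⁻¹ y) = f y := (γ (ρ e))⁻¹.2 y
      have h3 := W.seminorm_smul_single 1 e
      rw [one_smul, Int.cast_one, abs_one, Real.one_rpow, mul_one] at h3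
      rw [show F (.a e) = κ (ρ e) (.ofAdd (Pi.single e 1)) from rfl, hκf, ← h2]
      exact h1.trans (h3.trans_le (hxM _))
    · have h1 : F (.s e) ∈ levelPreserving f :=
        mul_mem (mul_mem (γ (ρ e)).2 (hsf e)) (inv_mem (γ (σ e)).2)
      rw [h1 y, sub_self, abs_zero]
      exact hM
  obtain ⟨y, hy⟩ := exists_height_translation_eq ν (N • diagVec ρ v)
  have hΦ := congrArg (PresentedGroup.toGroup hrel) hw
  have hΦw : FreeGroup.lift F (FreeGroup.mk w) = κ v (.ofAdd (N • diagVec ρ v)) := by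
    rw [ofAdd_zsmul, map_zpow, ← hdiag, ← map_zpow]
    rw [diag, ← map_zpow] at hΦ
    exact hΦ
  -- The point `γ v y` undoes the conjugation by `γ v` in the action of the vertex group.
  have hlen := abs_sub_le_length_mul f F hFM w ((γ v : Equiv.Perm (ActionSpace ν)) y)
  rw [hΦw, hκf, show (γ v).1⁻¹ ((γ v).1 y) = y from (γ v).1.symm_apply_apply y,
    (γ v).2 y] at hlen
  rw [← W.seminorm_smul_diagVec]
  exact (hy.symm.le.trans (le_abs_self _)).trans hlen

end Snowflake

theorem mainTheorem10 {k : ℕ} (P : Matrix (Fin k) (Fin k) ℕ)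
    (hP : (P.map (Nat.cast : ℕ → ℝ)).IsIrreducible)
    (lam : ℝ) (hlam : Snowflake.IsPerronFrobeniusEigenvalue (P.map (Nat.cast : ℕ → ℝ)) lam)
    (hlam1 : 1 < lam)
    (p q : ℕ) (hq : 0 < q) (hpq : ∀ i, (∑ j, (P i j : ℝ)) < (p : ℝ) / (q : ℝ)) :
    ∃ D : ℝ, 0 < D ∧
      ∀ (n : ℕ) (ρ σ : Fin n → Fin k), Snowflake.IsGraphOf P ρ σ →
      ∀ T : Set (Fin n), Snowflake.IsMaximalTree ρ σ T →
      ∀ (v : Fin k) (N : ℤ) (w : List (Snowflake.Gen n × Bool)),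
        Snowflake.wordValue p q ρ σ T w = Snowflake.diag p q ρ σ T v ^ N →
        |(N : ℝ)| ≤ D * (w.length : ℝ) ^ Real.logb lam ((p : ℝ) / (q : ℝ)) := by
  obtain ⟨x, hx, hxpos⟩ := hlam
  have hlam0 : 0 < lam := one_pos.trans hlam1
  have hq' : (0 : ℝ) < q := Nat.cast_pos.2 hq
  have hPx : ∀ i, ∑ j, (P i j : ℝ) * x j = lam * x i := fun i => by
    simpa [Matrix.mulVec, dotProduct] using congrFun hx.apply_eq_smul i
  have : Nonempty (Fin k) := by
    by_contra h
    rw [not_nonempty_iff] at h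
    exact hx.2 (Subsingleton.elim _ _)
  have hlamr : lam < (p : ℝ) / q := by
    obtain ⟨i, hi⟩ := Finite.exists_max x
    refine lt_of_mul_lt_mul_right ?_ (hxpos i).le
    calc lam * x i = ∑ j, (P i j : ℝ) * x j := (hPx i).symm
      _ ≤ ∑ j, (P i j : ℝ) * x i :=
        Finset.sum_le_sum fun j _ => mul_le_mul_of_nonneg_left (hi j) (Nat.cast_nonneg _)
      _ = (∑ j, (P i j : ℝ)) * x i := (Finset.sum_mul ..).symm
      _ < (p : ℝ) / q * x i := mul_lt_mul_of_pos_right (hpq i) (hxpos i)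
  have hr : 0 < (p : ℝ) / q := hlam0.trans hlamr
  have hp : 0 < p := Nat.cast_pos.1 ((div_pos_iff_of_pos_right hq').1 hr)
  set α := Real.logb lam ((p : ℝ) / q)
  have hα1 : 1 < α := by
    rwa [Real.lt_logb_iff_rpow_lt hlam1 hr, Real.rpow_one]
  have hα0 : 0 < α := one_pos.trans hα1
  have hlamα : lam ^ α = (p : ℝ) / q := Real.rpow_logb hlam0 hlam1.ne' hr
  obtain ⟨i₀, hmin⟩ := Finite.exists_min x
  obtain ⟨i₁, hmax⟩ := Finite.exists_max x
  have hx0 := hxpos i₀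
  have hx1 := hxpos i₁
  -- A single generator has length at most `x i₁ / lam`, and `c_v ^ N` has length at least
  -- `x i₀ * |N| ^ α⁻¹`.
  refine ⟨(x i₁ / lam / x i₀) ^ α, by positivity, fun n ρ σ hG T hT v N w hw => ?_⟩
  let W : Snowflake.VertexWeights ρ σ :=
    { x := x
      lam := lam
      β := α⁻¹
      x_pos := hxpos
      lam_pos := hlam0
      β_pos := inv_pos.2 hα0
      β_le := inv_le_one_of_one_le₀ hα1.le
      sum_eq := fun i => by
        rw [← hPx, ← Finset.sum_fiberwise _ σ]
        refine Finset.sum_congr rfl fun j _ => ?_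
        rw [← hG i j, ← nsmul_eq_mul, ← Finset.sum_const, Finset.filter_filter]
        exact Finset.sum_congr rfl fun e he => by rw [(Finset.mem_filter.1 he).2.2] }
  have hpq' : (p : ℝ) ^ W.β = W.lam * (q : ℝ) ^ W.β := by
    rw [← div_eq_iff (by positivity), ← Real.div_rpow (Nat.cast_nonneg _) (Nat.cast_nonneg _),
      ← hlamα]
    exact Real.rpow_rpow_inv hlam0.le hα0.ne'
  have hkey := W.mul_abs_rpow_le_length_mul hp hq hpq' hT (M := x i₁ / lam) (by positivity)
    (fun u => div_le_div_of_nonneg_right (hmax u) hlam0.le) hw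
  have hbound : |(N : ℝ)| ^ α⁻¹ ≤ x i₁ / lam / x i₀ * w.length := by
    rw [div_mul_eq_mul_div, le_div_iff₀' hx0, mul_comm (x i₁ / lam)]
    exact (mul_le_mul_of_nonneg_right (hmin v) (by positivity)).trans hkey
  calc |(N : ℝ)| = (|(N : ℝ)| ^ α⁻¹) ^ α := (Real.rpow_inv_rpow (abs_nonneg _) hα0.ne').symm
    _ ≤ (x i₁ / lam / x i₀ * w.length) ^ α := Real.rpow_le_rpow (by positivity) hbound hα0.le
    _ = _ := Real.mul_rpow (by positivity) (Nat.cast_nonneg _)
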